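/- Let $V$ be a finite set and let $p:V\times V\to[0,1]$ be the transition function of a Markov chain, $\sum_{y}p(x,y)=1$ for all $x\in V$. Assume that the chain is irreducible and has symmetric support, i.e. $p(x,y)>0$ if and only if $p(y,x)>0$; reversibility is not assumed. Let $G$ be the graph on $V$ in which $x\sim y$ if and only if $x\neq y$ and $p(x,y)>0$. Let $d:V\times V\to[0,\infty)$ be a general path distance, that is, $d$ is symmetric, $d(x,y)=0$ if and only if $x=y$, and $$d(x,y)=\inf\Big\{\sum_{k=1}^{n}d(x_{k-1},x_k)\;:\;x=x_0\sim x_1\sim\dots\sim x_n=y\Big\}\qquad\text{for all }x,y\in V.$$ For $f:V\to\mathbb R$ put $\Delta f(x)=\sum_{y}p(x,y)(f(y)-f(x))$ and, for $x\ne y$, $\nabla_{xy}f=\frac{f(x)-f(y)}{d(x,y)}$; let $\|\nabla f\|_\infty=\sup_{x\neq y}|\nabla_{xy}f|$. The Ollivier curvature of $x\neq y$ is $$\kappa(x,y)=\inf\{\nabla_{xy}\Delta f\;:\;\nabla_{yx}f=1,\ \|\nabla f\|_\infty=1\}.$$ Let $M_2(G)$ be the two-dimensional cell complex whose $0$-cells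 are the vertices, whose $1$-cells are the edges $\{x,y\}$ with $x\sim y$, and whose $2$-cells are the cycles of $G$ (injective paths $x_0\sim x_1\sim\dots\sim x_{n-1}$ with $x_{n-1}\sim x_0$ and $n\ge 3$, up to rotation and reflection of the labelling) which have $n=3$, or which for some labelling satisfy $d(x_0,x_3)<d(x_0,x_1)+d(x_1,x_2)+d(x_2,x_3)$ with $x_3\sim\dots\sim x_{n-1}\sim x_0$ a geodesic (its $d$-length is $d(x_3,x_0)$). A $1$-cochain is a real function $\alpha$ on oriented edges with $\alpha(x,y)=-\alpha(y,x)$. The coboundary maps are $\delta_0f(x,y)=f(x)-f(y)$ for $f:V\to\mathbb R$ and $x\sim y$, and $\delta_1\alpha(x_0\sim\dots\sim x_{n-1})=\sum_{i=0}^{n-1}\alpha(x_i,x_{i+1\bmod n})$ on $2$-cells; the first Betti number is $\beta_1(M_2(G))=\dim(\ker\delta_1/\operatorname{Im}\delta_0)$. Assume that $G$ has non-negative Ollivier curvature, i.e. $\kappa(x,y)\ge 0$ for all $x\sim y$, and that there is a vertex $x\in V$ such that $\kappa(x,y)>0$ for all $y\neq x$ with $p(x,y)>0$. Then $\beta_1(M_2(G))=0$.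 -/

import Mathlib

/-- A Markov chain on a finite state space `V`, with the standing assumptions: it is irreducible
and its transition kernel has symmetric support. Neither reversibility nor the absence of loops
(`p x x = 0`) is required. -/
structure MarkovChain (V : Type*) [Fintype V] where
  /-- the transition probabilities -/
  p : V → V → ℝ
  nonneg : ∀ x y, 0 ≤ p x y
  sum_eq_one : ∀ x, ∑ y, p x y = 1
  /-- any state can be reached from any state by steps of positive probability -/
  irreducible : ∀ x y, Relation.ReflTransGen (fun a b => 0 < p a b) x y
  symm_support : ∀ x y, 0 < p x y ↔ 0 < p y x

/-- The length of a walk with respect to a function `d` of pairs of vertices: the sum of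
`d x y` over the steps `x ∼ y` of the walk. -/
def walkLength {V : Type*} {G : SimpleGraph V} (d : V → V → ℝ) {u v : V} (w : G.Walk u v) : ℝ :=
  (w.darts.map fun e => d e.fst e.snd).sum

/-- A walk is a geodesic if its length is the distance of its endpoints. -/
def IsGeodesic {V : Type*} {G : SimpleGraph V} (d : V → V → ℝ) {u v : V} (w : G.Walk u v) : Prop :=
  walkLength d w = d u v

/-- General path distances on a graph `G`: `d` is symmetric, non-negative, vanishes exactly on the
diagonal, and `d x y` is the infimum of the `d`-lengths of the walks from `x` to `y`. -/
structure IsPathDistance {V : Type*} (G : SimpleGraph V) (d : V → V → ℝ) : Prop where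
  nonneg : ∀ x y, 0 ≤ d x y
  symm : ∀ x y, d x y = d y x
  eq_zero_iff : ∀ x y, d x y = 0 ↔ x = y
  isGLB : ∀ x y, IsGLB (Set.range fun w : G.Walk x y => walkLength d w) (d x y)

/-- The gradient `∇_{xy} f = (f x - f y) / d x y`, used for `x ≠ y`. -/
noncomputable def grad {V : Type*} (d : V → V → ℝ) (x y : V) (f : V → ℝ) : ℝ :=
  (f x - f y) / d x y

/-- The Lipschitz constant `‖∇f‖_∞ = sup_{x ≠ y} |∇_{xy} f|` (`V` is finite in all uses). -/
noncomputable def lipConst {V : Type*} (d : V → V → ℝ) (f : V → ℝ) : ℝ :=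
  ⨆ q : {q : V × V // q.1 ≠ q.2}, |grad d q.1.1 q.1.2 f|

/-- The 2-cells of `M_2(G)`, each with a starting point and a direction: cycles
`x_0 ∼ x_1 ∼ ⋯ ∼ x_{n-1} ∼ x_0` with `n = 3`, or with
`d(x_0, x_3) < d(x_0, x_1) + d(x_1, x_2) + d(x_2, x_3)` and `x_3 ∼ ⋯ ∼ x_{n-1} ∼ x_0` a geodesic.
Labellings of one cycle that differ by a rotation or a reflection describe the same cell; the
coboundary of a 1-cochain takes on them the same value up to sign, so that its kernel
is not affected by listing a cell once for each admissible labelling. -/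
structure TwoCell {V : Type*} (G : SimpleGraph V) (d : V → V → ℝ) where
  base : V
  walk : G.Walk base base
  isCycle : walk.IsCycle
  admissible : walk.length = 3 ∨
    (d base (walk.getVert 3) < d base (walk.getVert 1) + d (walk.getVert 1) (walk.getVert 2)
        + d (walk.getVert 2) (walk.getVert 3) ∧
      IsGeodesic d (walk.drop 3))

/-- The space `C(X_1)` of 1-cochains on the edges of `G`: `α x y` is the value of `α` on the edge
`{x, y}` oriented from `x` to `y`, so `α` is antisymmetric, and it is zero off the edges. -/
def Cochain1 {V : Type*} (G : SimpleGraph V) : Submodule ℝ (V → V → ℝ) where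
  carrier := {α | (∀ x y, α x y = -α y x) ∧ ∀ x y, ¬ G.Adj x y → α x y = 0}
  zero_mem' := by simp
  add_mem' := by
    rintro a b ⟨ha, ha'⟩ ⟨hb, hb'⟩
    refine ⟨fun x y => ?_, fun x y h => ?_⟩
    · simp only [Pi.add_apply]
      rw [ha x y, hb x y]
      ring
    · simp [ha' x y h, hb' x y h]
  smul_mem' := by
    rintro c a ⟨ha, ha'⟩
    refine ⟨fun x y => ?_, fun x y h => ?_⟩
    · simp only [Pi.smul_apply, smul_eq_mul]
      rw [ha x y]
      ring
    · simp [ha' x y h]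

instance {V : Type*} (G : SimpleGraph V) : AddCommGroup (Cochain1 G) :=
  Submodule.addCommGroup _

open Classical in
/-- The coboundary `δ_0 : C(X_0) → C(X_1)`, `δ_0 f (x, y) = f x - f y` on edges. -/
noncomputable def coboundary0 {V : Type*} (G : SimpleGraph V) : (V → ℝ) →ₗ[ℝ] Cochain1 G where
  toFun f := ⟨fun x y => if G.Adj x y then f x - f y else 0, by
    refine ⟨fun x y => ?_, fun x y h => if_neg h⟩
    change (if G.Adj x y then f x - f y else 0) = -(if G.Adj y x then f y - f x else 0)
    by_cases h : G.Adj x y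
    · rw [if_pos h, if_pos h.symm]
      ring
    · rw [if_neg h, if_neg fun h' => h h'.symm]
      simp⟩
  map_add' f g := by
    ext x y
    by_cases h : G.Adj x y
    · simp [h]
      ring
    · simp [h]
  map_smul' c f := by
    ext x y
    by_cases h : G.Adj x y
    · simp [h]
      ring
    · simp [h]

/-- The coboundary `δ_1 : C(X_1) → C(X_2)`,
`δ_1 α (x_0 ∼ ⋯ ∼ x_{n-1}) = ∑ i, α (x_i, x_{i+1 mod n})`. -/
def coboundary1 {V : Type*} (G : SimpleGraph V) (d : V → V → ℝ) :
    Cochain1 G →ₗ[ℝ] (TwoCell G d → ℝ) where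
  toFun α c := walkLength α.1 c.walk
  map_add' a b := by
    ext c
    simp [walkLength, List.sum_map_add]
  map_smul' r a := by
    ext c
    simp [walkLength, List.sum_map_mul_left]

theorem walkLength_coboundary0 {V : Type*} (G : SimpleGraph V) (f : V → ℝ) {u v : V}
    (w : G.Walk u v) : walkLength (coboundary0 G f).1 w = f u - f v := by
  induction w with
  | nil => simp [walkLength]
  | cons h w ih =>
    have h2 : ∀ (x y z : V) (hxy : G.Adj x y) (w' : G.Walk y z),
        walkLength (coboundary0 G f).1 (SimpleGraph.Walk.cons hxy w')
          = (coboundary0 G f).1 x y + walkLength (coboundary0 G f).1 w' := by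
      intro x y z hxy w'
      simp [walkLength]
    rw [h2, ih]
    simp [coboundary0, h]

/-- The cellular cochain maps form a complex. -/
theorem coboundary1_comp_coboundary0 {V : Type*} (G : SimpleGraph V) (d : V → V → ℝ) :
    coboundary1 G d ∘ₗ coboundary0 G = 0 := by
  ext f c
  simp only [LinearMap.comp_apply]
  exact (walkLength_coboundary0 G _ c.walk).trans (sub_self _)

/-- The first Betti number `β_1(M_2(G)) = dim (ker δ_1 / im δ_0)`. -/
noncomputable def betti1 {V : Type*} (G : SimpleGraph V) (d : V → V → ℝ) : ℕ :=
  Module.finrank ℝ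
    (LinearMap.ker (coboundary1 G d) ⧸
      (LinearMap.range (coboundary0 G)).submoduleOf (LinearMap.ker (coboundary1 G d)))

namespace MarkovChain

variable {V : Type*} [Fintype V] (M : MarkovChain V)

/-- The graph of the chain: distinct `x`, `y` are adjacent if `p x y > 0`. -/
def graph : SimpleGraph V where
  Adj x y := x ≠ y ∧ 0 < M.p x y
  symm := ⟨fun x y h => ⟨h.1.symm, (M.symm_support x y).1 h.2⟩⟩
  loopless := ⟨fun _ h => h.1 rfl⟩

/-- The Laplacian `Δ f x = ∑ y, p x y (f y - f x)`. -/
def laplacian (f : V → ℝ) (x : V) : ℝ :=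
  ∑ y, M.p x y * (f y - f x)

/-- The Ollivier curvature of a pair `x ≠ y`: the infimum of `∇_{xy} Δ f` over all `f` with
`∇_{yx} f = 1` and `‖∇f‖_∞ = 1`. -/
noncomputable def curvature (d : V → V → ℝ) (x y : V) : ℝ :=
  sInf ((fun f => grad d x y (M.laplacian f)) '' {f : V → ℝ | grad d y x f = 1 ∧ lipConst d f = 1})

end MarkovChain

/-! After subtracting a coboundary, a closed 1-cochain has constant divergence
(`exists_divergence_eq_const`). It remains to see that it then vanishes
(`cochain_eq_zero_of_curvature`).

On the cover `V × ℝ` the cochain is the increment of the height, and the height has constant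
Laplacian. Suppose that its largest slope `L` is positive, and call the edges of slope `L` maximal.
A path of two or three edges can be traded for a geodesic by means of 2-cells (`IsTame.two_steps`,
`IsTame.three_steps`). So near an edge the height is `L`-Lipschitz, and points of extremal height
difference are joined by maximal edges. Hence the height plus `ε * Φ`, with `Φ` constant along
maximal edges and `ε` small, is up to scaling a test function for the curvature of a maximal edge
(`eventually_curvature_mul_le`). With `Φ = 0` this gives curvature at most `0` on maximal edges.
With both signs of `ε` and non-negative curvature, averaging maps functions constant along maximal
edges to such functions.

Finally, maximal edges meet every vertex (`exists_isMaxStepEnd`), which contradicts positive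
curvature at `x`. If they missed `x`, all classes of points joined by maximal edges would have
bounded height. The oscillation of height over a class would then be a function on `V` that strictly
increases under averaging wherever it is positive, which is impossible at its maximum. -/

/-! ### Lengths of walks -/

section WalkLength

variable {V : Type*} {G : SimpleGraph V}

@[simp] theorem walkLength_nil (d : V → V → ℝ) (u : V) :
    walkLength d (SimpleGraph.Walk.nil : G.Walk u u) = 0 := by
  simp [walkLength]

@[simp] theorem walkLength_cons (d : V → V → ℝ) {u v w : V} (h : G.Adj u v) (q : G.Walk v w) :
    walkLength d (SimpleGraph.Walk.cons h q) = d u v + walkLength d q := by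
  simp [walkLength]

@[simp] theorem walkLength_append (d : V → V → ℝ) {u v w : V} (q : G.Walk u v) (r : G.Walk v w) :
    walkLength d (q.append r) = walkLength d q + walkLength d r := by
  simp [walkLength]

@[simp] theorem walkLength_copy (d : V → V → ℝ) {u v u' v' : V} (q : G.Walk u v) (hu : u = u')
    (hv : v = v') : walkLength d (q.copy hu hv) = walkLength d q := by
  subst hu hv
  rfl

theorem walkLength_reverse_of_symm {d : V → V → ℝ} (hd : ∀ x y, d x y = d y x) {u v : V}
    (q : G.Walk u v) : walkLength d q.reverse = walkLength d q := by
  induction q with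
  | nil => simp
  | cons h q ih => simp [ih, hd, add_comm]

theorem walkLength_reverse_of_antisymm {β : V → V → ℝ} (hβ : ∀ x y, β x y = -β y x) {u v : V}
    (q : G.Walk u v) : walkLength β q.reverse = -walkLength β q := by
  induction q with
  | nil => simp
  | @cons u v w h q ih => simp [ih, hβ v u]

theorem walkLength_nonneg {d : V → V → ℝ} (hd : ∀ x y, 0 ≤ d x y) {u v : V} (q : G.Walk u v) :
    0 ≤ walkLength d q := by
  induction q with
  | nil => simp
  | cons h q ih => simpa using add_nonneg (hd _ _) ih

open Classical in
theorem walkLength_bypass_le {d : V → V → ℝ} (hd : ∀ x y, 0 ≤ d x y) {u v : V}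
    (q : G.Walk u v) : walkLength d q.bypass ≤ walkLength d q := by
  induction q with
  | nil => simp [SimpleGraph.Walk.bypass]
  | @cons u v w h q ih =>
    rw [SimpleGraph.Walk.bypass]
    split_ifs with hs
    · have := congrArg (walkLength d) (SimpleGraph.Walk.take_spec q.bypass hs)
      rw [walkLength_append] at this
      have := walkLength_nonneg hd (q.bypass.takeUntil u hs)
      have := hd u v
      rw [walkLength_cons]
      linarith
    · simpa using ih

end WalkLength

/-! ### Geodesics of a path distance -/

namespace IsPathDistance

variable {V : Type*} {G : SimpleGraph V} {d : V → V → ℝ}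

theorem le_walkLength (hd : IsPathDistance G d) {x y : V} (q : G.Walk x y) :
    d x y ≤ walkLength d q :=
  (hd.isGLB x y).1 ⟨q, rfl⟩

theorem self (hd : IsPathDistance G d) (x : V) : d x x = 0 := (hd.eq_zero_iff x x).2 rfl

theorem pos (hd : IsPathDistance G d) {x y : V} (h : x ≠ y) : 0 < d x y :=
  lt_of_le_of_ne (hd.nonneg x y) fun h' => h ((hd.eq_zero_iff x y).1 h'.symm)

-- Erasing loops does not lengthen a walk, so the infimum is taken over the finitely many paths.
open Classical in
theorem exists_geodesic [Finite V] (hd : IsPathDistance G d) (x y : V) :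
    ∃ q : G.Walk x y, q.IsPath ∧ IsGeodesic d q := by
  have := Fintype.ofFinite V
  have hne : Nonempty (G.Walk x y) := by
    by_contra hne
    rw [not_nonempty_iff] at hne
    have h := (hd.isGLB x y).2
    -- Without walks every real number is a lower bound, so there is no greatest one.
    have h1 : d x y + 1 ∈ lowerBounds (Set.range fun w : G.Walk x y => walkLength d w) := by
      rintro _ ⟨q, -⟩
      exact hne.elim q
    linarith [h h1]
  have : Nonempty (G.Path x y) := ⟨hne.some.toPath⟩
  obtain ⟨q, hq⟩ := Finite.exists_min fun q : G.Path x y => walkLength d q.1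
  refine ⟨q.1, q.2, le_antisymm ?_ (hd.le_walkLength _)⟩
  refine (hd.isGLB x y).2 ?_
  rintro _ ⟨r, rfl⟩
  exact (hq r.toPath).trans (walkLength_bypass_le hd.nonneg r)

theorem triangle [Finite V] (hd : IsPathDistance G d) (x y z : V) :
    d x z ≤ d x y + d y z := by
  obtain ⟨q, -, hq⟩ := hd.exists_geodesic x y
  obtain ⟨r, -, hr⟩ := hd.exists_geodesic y z
  have := hd.le_walkLength (q.append r)
  rwa [walkLength_append, hq, hr] at this

open Classical in
theorem eq_add_of_mem_support [Finite V] (hd : IsPathDistance G d) {x y z : V} {q : G.Walk x y}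
    (hq : IsGeodesic d q) (hz : z ∈ q.support) : d x y = d x z + d z y := by
  have h := congrArg (walkLength d) (SimpleGraph.Walk.take_spec q hz)
  rw [walkLength_append, hq] at h
  have := hd.le_walkLength (q.takeUntil z hz)
  have := hd.le_walkLength (q.dropUntil z hz)
  have := hd.triangle x z y
  linarith

theorem isGeodesic_of_cons [Finite V] (hd : IsPathDistance G d) {x y z : V} {h : G.Adj x y}
    {q : G.Walk y z} (hq : IsGeodesic d (SimpleGraph.Walk.cons h q)) :
    IsGeodesic d q ∧ d x z = d x y + d y z := by
  have h1 : d x y + walkLength d q = d x z := by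
    simpa [IsGeodesic] using hq
  have := hd.triangle x y z
  have := hd.le_walkLength q
  exact ⟨by unfold IsGeodesic; linarith, by linarith⟩

end IsPathDistance

/-! ### Slopes on the cover and the role of the 2-cells -/

section Cover

variable {V : Type*} {G : SimpleGraph V} {d β : V → V → ℝ} {L : ℝ}

/-- Steps of maximal slope `L` in the cover `V × ℝ` of `G` on which the cochain `β` becomes the
increment of the second coordinate. -/
def MaxStep (G : SimpleGraph V) (d β : V → V → ℝ) (L : ℝ) (P Q : V × ℝ) : Prop :=
  G.Adj P.1 Q.1 ∧ Q.2 = P.2 + β P.1 Q.1 ∧ β P.1 Q.1 = L * d P.1 Q.1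

/-- An increment `r` from `z` to `w` respects the slope `L`, and if it is extremal then it is
realized by steps of maximal slope. -/
def IsTame (G : SimpleGraph V) (d β : V → V → ℝ) (L : ℝ) (z w : V) (r : ℝ) : Prop :=
  r ≤ L * d z w ∧
    (r = L * d z w → ∀ s, Relation.EqvGen (MaxStep G d β L) (z, s) (w, s + r))

theorem walkLength_le_mul (hL : ∀ x y, G.Adj x y → β x y ≤ L * d x y) {u v : V}
    (q : G.Walk u v) : walkLength β q ≤ L * walkLength d q := by
  induction q with
  | nil => simp
  | cons h q ih =>
    simp only [walkLength_cons, mul_add]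
    exact add_le_add (hL _ _ h) ih

theorem eqvGen_maxStep_of_walkLength_eq (hL : ∀ x y, G.Adj x y → β x y ≤ L * d x y) {u v : V}
    (q : G.Walk u v) (hq : walkLength β q = L * walkLength d q) (s : ℝ) :
    Relation.EqvGen (MaxStep G d β L) (u, s) (v, s + walkLength β q) := by
  induction q generalizing s with
  | nil => simpa using Relation.EqvGen.refl _
  | @cons u v w h q ih =>
    simp only [walkLength_cons, mul_add] at hq ⊢
    have h1 := hL _ _ h
    have h2 := walkLength_le_mul hL q
    have := ih (by linarith) (s + β u v)
    rw [← add_assoc]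
    exact (Relation.EqvGen.rel _ _ ⟨h, rfl, by dsimp only; linarith⟩).trans _ _ _ this

theorem IsTame.of_isGeodesic (hL : ∀ x y, G.Adj x y → β x y ≤ L * d x y) {u v : V}
    {q : G.Walk u v} (hq : IsGeodesic d q) : IsTame G d β L u v (walkLength β q) := by
  unfold IsTame
  rw [← hq]
  exact ⟨walkLength_le_mul hL q, eqvGen_maxStep_of_walkLength_eq hL q⟩

theorem IsTame.of_adj (hL : ∀ x y, G.Adj x y → β x y ≤ L * d x y) {u v : V} (h : G.Adj u v) :
    IsTame G d β L u v (β u v) := by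
  have : IsGeodesic d (SimpleGraph.Walk.cons h .nil) := by simp [IsGeodesic]
  simpa using IsTame.of_isGeodesic hL this

theorem IsTame.refl (hd : IsPathDistance G d) (u : V) : IsTame G d β L u u 0 :=
  ⟨by simp [hd.self], fun _ s => by simpa using Relation.EqvGen.refl _⟩

theorem IsTame.add {z a w : V} {r s : ℝ} (h : IsTame G d β L z a r) (h' : IsTame G d β L a w s)
    (hadd : d z w = d z a + d a w) : IsTame G d β L z w (r + s) := by
  obtain ⟨h1, h2⟩ := h
  obtain ⟨h3, h4⟩ := h'
  unfold IsTame
  rw [hadd, mul_add]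
  refine ⟨add_le_add h1 h3, fun he t => ?_⟩
  rw [← add_assoc]
  exact (h2 (by linarith) t).trans _ _ _ (h4 (by linarith) _)

variable [Finite V]

/-- If the two steps are not geodesic, a geodesic back from `w` to `z` avoids `a` and closes them up
to a 2-cell. As the cochain is closed, the steps have the increment of the geodesic. -/
theorem IsTame.two_steps (hd : IsPathDistance G d) (hβ : ∀ x y, β x y = -β y x)
    (hcl : ∀ c : TwoCell G d, walkLength β c.walk = 0)
    (hL : ∀ x y, G.Adj x y → β x y ≤ L * d x y) {z a w : V} (hza : G.Adj z a) (haw : G.Adj a w) :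
    IsTame G d β L z w (β z a + β a w) := by
  by_cases hlt : d z a + d a w ≤ d z w
  · exact (IsTame.of_adj hL hza).add (IsTame.of_adj hL haw) (le_antisymm (hd.triangle _ _ _) hlt)
  push Not at hlt
  obtain ⟨q, hp, hq⟩ := hd.exists_geodesic w z
  have ha : a ∉ q.support := fun ha => by
    have := hd.eq_add_of_mem_support hq ha
    rw [hd.symm w z, hd.symm w a, hd.symm a z] at this
    linarith
  have key : β z a + β a w = walkLength β q.reverse := by
    rw [walkLength_reverse_of_antisymm hβ]
    cases q with
    | nil => simp [hβ z a]
    | @cons _ y _ hwy q =>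
      obtain ⟨hq', he⟩ := hd.isGeodesic_of_cons hq
      have hzq : z ≠ w := by
        rintro rfl
        simp at hp
      -- Here `x_3` is the second vertex `y` of the geodesic. For a triangle `y = z`, and the
      -- geodesic remainder of the cell is empty.
      have := hcl ⟨z, .cons hza (.cons haw (.cons hwy q)), by
        rw [SimpleGraph.Walk.cons_isCycle_iff, SimpleGraph.Walk.cons_isPath_iff]
        refine ⟨⟨hp, ha⟩, ?_⟩
        rw [SimpleGraph.Walk.edges_cons, List.mem_cons, not_or]
        refine ⟨?_, fun h => ha (SimpleGraph.Walk.snd_mem_support_of_mem_edges _ h)⟩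
        simp only [Sym2.eq_iff, not_or, not_and]
        exact ⟨fun h => (hza.ne h).elim, fun h => (hzq h).elim⟩,
        Or.inr ⟨by
          have := hd.symm w z
          have := hd.symm y z
          simp only [SimpleGraph.Walk.getVert_cons_succ, SimpleGraph.Walk.getVert_zero]
          linarith [hd.nonneg w y], by
          simpa [IsGeodesic, SimpleGraph.Walk.drop] using hq'⟩⟩
      simp only [walkLength_cons] at this ⊢
      linarith
  rw [key]
  refine IsTame.of_isGeodesic hL ?_
  unfold IsGeodesic
  rw [walkLength_reverse_of_symm hd.symm, hq, hd.symm]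

/-- A geodesic from `w` to `z` through `a` or `b` splits the problem into one and two steps.
Otherwise it closes the three steps up to a 2-cell with `x_3 = w`. -/
theorem IsTame.three_steps (hd : IsPathDistance G d) (hβ : ∀ x y, β x y = -β y x)
    (hcl : ∀ c : TwoCell G d, walkLength β c.walk = 0)
    (hL : ∀ x y, G.Adj x y → β x y ≤ L * d x y) {z a b w : V} (hza : G.Adj z a) (hab : G.Adj a b)
    (hbw : G.Adj b w) : IsTame G d β L z w (β z a + β a b + β b w) := by
  by_cases hlt : d z a + d a b + d b w ≤ d z w
  · have hg : IsGeodesic d (SimpleGraph.Walk.cons hza (.cons hab (.cons hbw .nil))) := by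
      have := hd.triangle z b w
      have := hd.triangle z a b
      simp only [IsGeodesic, walkLength_cons, walkLength_nil]
      linarith
    have := IsTame.of_isGeodesic hL hg
    simpa [add_assoc] using this
  push Not at hlt
  obtain ⟨q, hp, hq⟩ := hd.exists_geodesic w z
  by_cases ha : a ∈ q.support
  · have := hd.eq_add_of_mem_support hq ha
    rw [hd.symm w z, hd.symm w a, hd.symm a z, add_comm] at this
    rw [add_assoc]
    exact (IsTame.of_adj hL hza).add (IsTame.two_steps hd hβ hcl hL hab hbw) this
  by_cases hb : b ∈ q.support
  · have := hd.eq_add_of_mem_support hq hb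
    rw [hd.symm w z, hd.symm w b, hd.symm b z, add_comm] at this
    exact (IsTame.two_steps hd hβ hcl hL hza hab).add (IsTame.of_adj hL hbw) this
  have hzb : z ≠ b := fun h => hb (h ▸ q.end_mem_support)
  have key : β z a + β a b + β b w = walkLength β q.reverse := by
    rw [walkLength_reverse_of_antisymm hβ]
    have := hcl ⟨z, .cons hza (.cons hab (.cons hbw q)), by
      rw [SimpleGraph.Walk.cons_isCycle_iff, SimpleGraph.Walk.cons_isPath_iff,
        SimpleGraph.Walk.cons_isPath_iff]
      refine ⟨⟨⟨hp, hb⟩, ?_⟩, ?_⟩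
      · rw [SimpleGraph.Walk.support_cons, List.mem_cons, not_or]
        exact ⟨hab.ne, ha⟩
      · rw [SimpleGraph.Walk.edges_cons, SimpleGraph.Walk.edges_cons, List.mem_cons,
          List.mem_cons, not_or, not_or]
        refine ⟨?_, ?_, fun h => ha (SimpleGraph.Walk.snd_mem_support_of_mem_edges _ h)⟩
        · simp only [Sym2.eq_iff, not_or, not_and]
          exact ⟨fun h => (hza.ne h).elim, fun h => (hzb h).elim⟩
        · simp only [Sym2.eq_iff, not_or, not_and]
          exact ⟨fun h => (hzb h).elim, fun _ => hab.ne⟩,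
      Or.inr ⟨by
        simpa [SimpleGraph.Walk.getVert_cons_succ] using hlt, by
        simpa [IsGeodesic, SimpleGraph.Walk.drop] using hq⟩⟩
    simp only [walkLength_cons] at this ⊢
    linarith
  rw [key]
  refine IsTame.of_isGeodesic hL ?_
  unfold IsGeodesic
  rw [walkLength_reverse_of_symm hd.symm, hq, hd.symm]

end Cover

/-! ### Test functions for the curvature -/

namespace MarkovChain

variable {V : Type*} [Fintype V] (M : MarkovChain V) {d : V → V → ℝ}

theorem abs_sub_le_of_lipConst_eq_one (hd : IsPathDistance M.graph d) {f : V → ℝ}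
    (hf : lipConst d f = 1) (u v : V) : |f u - f v| ≤ d u v := by
  by_cases huv : u = v
  · simp [huv, hd.self]
  have h : |grad d u v f| ≤ lipConst d f :=
    le_ciSup (f := fun q : {q : V × V // q.1 ≠ q.2} => |grad d q.1.1 q.1.2 f|)
      (Set.finite_range _).bddAbove ⟨(u, v), huv⟩
  rw [hf, grad, abs_div, abs_of_pos (hd.pos huv), div_le_one (hd.pos huv)] at h
  exact h

theorem abs_laplacian_le {f : V → ℝ} (hf : ∀ u v, |f u - f v| ≤ d u v) (a : V) :
    |M.laplacian f a| ≤ ∑ y, M.p a y * d y a := by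
  refine (Finset.abs_sum_le_sum_abs _ _).trans (Finset.sum_le_sum fun y _ => ?_)
  rw [abs_mul, abs_of_nonneg (M.nonneg a y)]
  exact mul_le_mul_of_nonneg_left (hf y a) (M.nonneg a y)

/-- Needed for `csInf_le`: a real `sInf` bounds nothing if the set is unbounded below. -/
theorem bddBelow_curvature (hd : IsPathDistance M.graph d) {a b : V} (hab : a ≠ b) :
    BddBelow ((fun f => grad d a b (M.laplacian f)) ''
      {f : V → ℝ | grad d b a f = 1 ∧ lipConst d f = 1}) := by
  refine ⟨(-(∑ y, M.p a y * d y a) - ∑ y, M.p b y * d y b) / d a b, ?_⟩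
  rintro _ ⟨f, ⟨-, hf⟩, rfl⟩
  have h := M.abs_sub_le_of_lipConst_eq_one hd hf
  have ha := abs_le.1 (M.abs_laplacian_le h a)
  have hb := abs_le.1 (M.abs_laplacian_le h b)
  exact div_le_div_of_nonneg_right (by linarith [ha.1, hb.2]) (hd.pos hab).le

theorem laplacian_const_mul (r : ℝ) (f : V → ℝ) (a : V) :
    M.laplacian (fun v => r * f v) a = r * M.laplacian f a := by
  simp only [laplacian, Finset.mul_sum]
  exact Finset.sum_congr rfl fun y _ => by ring

/-- A function with Lipschitz constant `L` which is extremal on `(a, b)` satisfies the curvature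
inequality. -/
theorem curvature_mul_le (hd : IsPathDistance M.graph d) {a b : V} (hab : a ≠ b) {g : V → ℝ}
    {L : ℝ} (hL : 0 < L) (hg : ∀ u v, g u - g v ≤ L * d u v) (he : g b - g a = L * d a b) :
    M.curvature d a b * (L * d a b) ≤ M.laplacian g a - M.laplacian g b := by
  have hpos := hd.pos hab
  have hgrad : grad d b a (fun v => L⁻¹ * g v) = 1 := by
    rw [grad, ← mul_sub, he, hd.symm b a]
    field_simp
  have hlip : lipConst d (fun v => L⁻¹ * g v) = 1 := by
    have : Nonempty {q : V × V // q.1 ≠ q.2} := ⟨⟨(b, a), hab.symm⟩⟩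
    refine le_antisymm (ciSup_le ?_) ?_
    · rintro ⟨⟨u, v⟩, huv⟩
      have huv' := hd.pos huv
      dsimp only at huv' ⊢
      rw [grad, ← mul_sub, abs_div, abs_of_pos huv', div_le_one huv', abs_mul,
        abs_of_pos (inv_pos.2 hL), inv_mul_le_iff₀ hL, abs_le]
      have := hg v u
      rw [hd.symm v u] at this
      exact ⟨by linarith, hg u v⟩
    · refine le_trans ?_ (le_ciSup (Set.finite_range _).bddAbove ⟨(b, a), hab.symm⟩)
      dsimp only
      rw [hgrad, abs_one]
  have h : M.curvature d a b ≤ grad d a b (M.laplacian fun v => L⁻¹ * g v) :=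
    csInf_le (M.bddBelow_curvature hd hab) ⟨_, ⟨hgrad, hlip⟩, rfl⟩
  rw [grad, M.laplacian_const_mul, M.laplacian_const_mul, le_div_iff₀ hpos, ← mul_sub,
    ← div_eq_inv_mul, le_div_iff₀ hL] at h
  linarith

end MarkovChain

/-- McShane extension, for a finite multivalued function on a finite set. -/
theorem exists_lipschitz_extension {V : Type*} [Finite V] {G : SimpleGraph V} {d : V → V → ℝ}
    (hd : IsPathDistance G d) {L : ℝ} (hL : 0 ≤ L) {ι : Type*} (F : Finset ι) (hF : F.Nonempty)
    (x : ι → V) (h : ι → ℝ)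
    (hh : ∀ P ∈ F, ∀ Q ∈ F, h P - h Q ≤ L * d (x P) (x Q)) :
    ∃ g : V → ℝ, (∀ u v, g u - g v ≤ L * d u v) ∧ ∀ P ∈ F, g (x P) = h P := by
  refine ⟨fun v => F.inf' hF fun P => h P + L * d (x P) v, fun u v => ?_, fun P hP => ?_⟩
  · obtain ⟨Q, hQ, he⟩ := F.exists_mem_eq_inf' hF fun P => h P + L * d (x P) v
    have h1 : F.inf' hF (fun P => h P + L * d (x P) u) ≤ h Q + L * d (x Q) u :=
      Finset.inf'_le _ hQ
    have h2 := mul_le_mul_of_nonneg_left (hd.triangle (x Q) v u) hL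
    rw [hd.symm v u] at h2
    dsimp only
    rw [he]
    linarith
  · refine le_antisymm ((Finset.inf'_le _ hP).trans_eq (by simp [hd.self])) ?_
    refine Finset.le_inf' _ _ fun Q hQ => ?_
    have := hh P hP Q hQ
    rw [hd.symm] at this
    linarith

section Perturbation

open Filter Topology

/-- A strict inequality survives small perturbations; an equality is not perturbed at all. -/
theorem eventually_add_mul_le {A B r : ℝ} (h : A ≤ B) (he : A = B → r = 0) :
    ∀ᶠ ε : ℝ in 𝓝 0, A + ε * r ≤ B := by
  rcases h.eq_or_lt with h | h
  · simp [he h, h]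
  · have : Tendsto (fun ε : ℝ => A + ε * r) (𝓝 0) (𝓝 (A + 0 * r)) :=
      (continuous_const.add (continuous_id.mul continuous_const)).tendsto 0
    rw [zero_mul, add_zero] at this
    exact (this.eventually_lt_const h).mono fun _ => le_of_lt

end Perturbation

/-! ### Harmonic cochains and invariance under averaging -/

section Invariance

variable {V : Type*} [Fintype V] {M : MarkovChain V} {d β : V → V → ℝ} {L c : ℝ}

/-- The hypotheses on a cochain `β` used in the maximum principle: it is antisymmetric, supported
on the edges, closed, its divergence is constant, and `L` bounds its slopes. -/
structure IsHarmonicCochain (M : MarkovChain V) (d β : V → V → ℝ) (L c : ℝ) : Prop where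
  pathDistance : IsPathDistance M.graph d
  antisymm : ∀ x y, β x y = -β y x
  eq_zero : ∀ x y, ¬ M.graph.Adj x y → β x y = 0
  closed : ∀ e : TwoCell M.graph d, walkLength β e.walk = 0
  divergence : ∀ a, ∑ z, M.p a z * β a z = c
  le_slope : ∀ x y, M.graph.Adj x y → β x y ≤ L * d x y
  slope_pos : 0 < L

/-- The averaging operator of the chain lifted to the cover `V × ℝ`. -/
noncomputable def liftAverage (M : MarkovChain V) (β : V → V → ℝ) (Φ : V × ℝ → ℝ) (P : V × ℝ) : ℝ :=
  ∑ z, M.p P.1 z * Φ (z, P.2 + β P.1 z)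

namespace IsHarmonicCochain

variable (H : IsHarmonicCochain M d β L c)
include H

theorem self (a : V) : β a a = 0 := H.eq_zero a a (M.graph.loopless.irrefl a)

theorem isTame_two {z a w : V} (hz : z = a ∨ M.graph.Adj a z) (hw : w = a ∨ M.graph.Adj a w) :
    IsTame M.graph d β L z w (β z a + β a w) := by
  rcases hz with rfl | hz <;> rcases hw with rfl | hw
  · simpa [H.self] using IsTame.refl H.pathDistance _
  · simpa [H.self] using IsTame.of_adj H.le_slope hw
  · simpa [H.self] using IsTame.of_adj H.le_slope hz.symm
  · exact IsTame.two_steps H.pathDistance H.antisymm H.closed H.le_slope hz.symm hw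

theorem isTame_three {z a b w : V} (hab : M.graph.Adj a b) (hz : z = a ∨ M.graph.Adj a z)
    (hw : w = b ∨ M.graph.Adj b w) : IsTame M.graph d β L z w (β z a + β a b + β b w) := by
  rcases hz with rfl | hz
  · simpa [H.self, H.antisymm b z] using H.isTame_two (Or.inr hab.symm) hw
  · rcases hw with rfl | hw
    · simpa [H.self] using H.isTame_two (Or.inr hz) (Or.inr hab)
    · exact IsTame.three_steps H.pathDistance H.antisymm H.closed H.le_slope hz.symm hab hw

end IsHarmonicCochain

end Invariance

section Invariance

open Filter Topology

variable {V : Type*} [Fintype V] {M : MarkovChain V} {d β : V → V → ℝ} {L c : ℝ}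

namespace IsHarmonicCochain

variable (H : IsHarmonicCochain M d β L c)
include H

/-- The height contributes only the divergence `c`, which cancels when two vertices are compared. -/
theorem laplacian_of_lift {a : V} {s ε : ℝ} {Φ : V × ℝ → ℝ} {g : V → ℝ}
    (hg : ∀ z, (z = a ∨ M.graph.Adj a z) → g z = s + β a z + ε * Φ (z, s + β a z)) :
    M.laplacian g a = c + ε * (liftAverage M β Φ (a, s) - Φ (a, s)) := by
  have h : ∀ z, M.p a z * (g z - g a) = M.p a z * β a z
      + ε * (M.p a z * Φ (z, s + β a z)) - ε * Φ (a, s) * M.p a z := by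
    intro z
    by_cases hp : 0 < M.p a z
    · have hz : z = a ∨ M.graph.Adj a z := by
        by_cases hz : z = a
        · exact Or.inl hz
        · exact Or.inr ⟨Ne.symm hz, hp⟩
      rw [hg z hz, hg a (Or.inl rfl), H.self, add_zero]
      ring
    · simp [le_antisymm (not_lt.1 hp) (M.nonneg a z)]
  rw [MarkovChain.laplacian, Finset.sum_congr rfl fun z _ => h z, Finset.sum_sub_distrib,
    Finset.sum_add_distrib, H.divergence, ← Finset.mul_sum, ← Finset.mul_sum, M.sum_eq_one,
    liftAverage]
  ring

/-- The lift of a harmonic cochain, perturbed by a function on the cover which is constant along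
steps of maximal slope, satisfies the curvature inequality. -/
theorem eventually_curvature_mul_le {a b : V} {s t : ℝ}
    (hab : MaxStep M.graph d β L (a, s) (b, t)) {Φ : V × ℝ → ℝ}
    (hΦ : ∀ P Q, MaxStep M.graph d β L P Q → Φ P = Φ Q) :
    ∀ᶠ ε : ℝ in 𝓝 0,
      M.curvature d a b * (L * d a b) ≤
        ε * (liftAverage M β Φ (a, s) - liftAverage M β Φ (b, t)) ∧
      M.curvature d b a * (L * d a b) ≤
        ε * (liftAverage M β Φ (a, s) - liftAverage M β Φ (b, t)) := by
  classical
  have hΦab := hΦ _ _ hab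
  obtain ⟨hadj, ht, hmax⟩ := hab
  dsimp only at hadj ht hmax
  have hΦ' : ∀ P Q, Relation.EqvGen (MaxStep M.graph d β L) P Q → Φ P = Φ Q := fun P Q h => by
    induction h with
    | rel _ _ h => exact hΦ _ _ h
    | refl => rfl
    | symm _ _ _ ih => exact ih.symm
    | trans _ _ _ _ _ ih ih' => exact ih.trans ih'
  let F : Finset (V × ℝ) :=
    (Finset.univ.filter fun z => z = a ∨ M.graph.Adj a z).image (fun z => (z, s + β a z)) ∪
      (Finset.univ.filter fun z => z = b ∨ M.graph.Adj b z).image (fun z => (z, t + β b z))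
  have hFa : ∀ z, (z = a ∨ M.graph.Adj a z) → (z, s + β a z) ∈ F := fun z hz =>
    Finset.mem_union_left _ (Finset.mem_image_of_mem _ (by simpa using hz))
  have hFb : ∀ z, (z = b ∨ M.graph.Adj b z) → (z, t + β b z) ∈ F := fun z hz =>
    Finset.mem_union_right _ (Finset.mem_image_of_mem _ (by simpa using hz))
  have hF : F.Nonempty := ⟨_, hFa a (Or.inl rfl)⟩
  -- This includes two points over one vertex: their distance `0` forces equal heights, so the
  -- perturbed height is single-valued.
  have htame : ∀ P ∈ F, ∀ Q ∈ F, IsTame M.graph d β L Q.1 P.1 (P.2 - Q.2) := by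
    intro P hP Q hQ
    simp only [F, Finset.mem_union, Finset.mem_image, Finset.mem_filter, Finset.mem_univ,
      true_and] at hP hQ
    rcases hP with ⟨w, hw, rfl⟩ | ⟨w, hw, rfl⟩ <;> rcases hQ with ⟨z, hz, rfl⟩ | ⟨z, hz, rfl⟩
    · convert H.isTame_two hz hw using 1
      rw [H.antisymm z a]; ring
    · convert H.isTame_three hadj.symm hz hw using 1
      rw [H.antisymm z b, H.antisymm b a, ht]; ring
    · convert H.isTame_three hadj hz hw using 1
      rw [H.antisymm z a, ht]; ring
    · convert H.isTame_two hz hw using 1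
      rw [H.antisymm z b]; ring
  have hlip : ∀ᶠ ε : ℝ in 𝓝 0, ∀ P ∈ F, ∀ Q ∈ F,
      (P.2 + ε * Φ P) - (Q.2 + ε * Φ Q) ≤ L * d P.1 Q.1 := by
    rw [Filter.eventually_all_finset]
    intro P hP
    rw [Filter.eventually_all_finset]
    intro Q hQ
    obtain ⟨h1, h2⟩ := htame P hP Q hQ
    rw [H.pathDistance.symm Q.1 P.1] at h1 h2
    refine (eventually_add_mul_le h1 (r := Φ P - Φ Q) fun h => ?_).mono fun ε hε => by linarith
    have := hΦ' _ _ (h2 h Q.2)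
    rw [add_sub_cancel] at this
    exact sub_eq_zero.2 this.symm
  refine hlip.mono fun ε hε => ?_
  obtain ⟨g, hg, hgF⟩ := exists_lipschitz_extension H.pathDistance H.slope_pos.le F hF Prod.fst
    (fun P => P.2 + ε * Φ P) hε
  have hga := H.laplacian_of_lift (a := a) (s := s) (ε := ε) (Φ := Φ) (g := g)
    fun z hz => hgF _ (hFa z hz)
  have hgb := H.laplacian_of_lift (a := b) (s := t) (ε := ε) (Φ := Φ) (g := g)
    fun z hz => hgF _ (hFb z hz)
  have hgba : g b - g a = L * d a b := by
    have h1 := hgF _ (hFa a (Or.inl rfl))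
    have h2 := hgF _ (hFb b (Or.inl rfl))
    simp only [H.self, add_zero] at h1 h2
    rw [h1, h2, hΦab, ← hmax, ht]
    ring
  have hdiff : M.laplacian g a - M.laplacian g b =
      ε * (liftAverage M β Φ (a, s) - liftAverage M β Φ (b, t)) := by
    rw [hga, hgb, hΦab]
    ring
  rw [← hdiff]
  refine ⟨M.curvature_mul_le H.pathDistance hadj.ne H.slope_pos hg hgba, ?_⟩
  -- For the reversed edge, `-g` is extremal.
  have h := M.curvature_mul_le H.pathDistance hadj.ne.symm H.slope_pos
    (g := fun v => -1 * g v) (fun u v => ?_) (by rw [H.pathDistance.symm b a]; linarith)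
  · rw [M.laplacian_const_mul, M.laplacian_const_mul, H.pathDistance.symm b a] at h
    linarith
  · have := hg v u
    rw [H.pathDistance.symm v u] at this
    linarith

theorem curvature_nonpos {a b : V} {s t : ℝ} (hab : MaxStep M.graph d β L (a, s) (b, t)) :
    M.curvature d a b ≤ 0 ∧ M.curvature d b a ≤ 0 := by
  have h := (H.eventually_curvature_mul_le hab (Φ := fun _ => 0) fun _ _ _ => rfl).self_of_nhds
  have hpos : 0 < L * d a b := mul_pos H.slope_pos (H.pathDistance.pos hab.1.ne)
  simp only [zero_mul] at h
  exact ⟨nonpos_of_mul_nonpos_left h.1 hpos, nonpos_of_mul_nonpos_left h.2 hpos⟩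

variable (hκ : ∀ x y : V, M.graph.Adj x y → 0 ≤ M.curvature d x y)
include hκ

theorem liftAverage_eq_of_maxStep {P Q : V × ℝ} (hPQ : MaxStep M.graph d β L P Q) {Φ : V × ℝ → ℝ}
    (hΦ : ∀ P Q, MaxStep M.graph d β L P Q → Φ P = Φ Q) :
    liftAverage M β Φ P = liftAverage M β Φ Q := by
  have h := H.eventually_curvature_mul_le (a := P.1) (s := P.2) (b := Q.1) (t := Q.2) hPQ hΦ
  have hpos : 0 < L * d P.1 Q.1 := mul_pos H.slope_pos (H.pathDistance.pos hPQ.1.ne)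
  obtain ⟨r, hr, hball⟩ := Metric.eventually_nhds_iff.1 h
  have h0 := mul_nonneg (hκ _ _ hPQ.1) hpos.le
  -- The left side is non-negative, so `ε = r / 2` and `ε = -(r / 2)` give opposite inequalities.
  have h1 := (hball (y := r / 2) (by rw [Real.dist_eq, sub_zero, abs_of_pos] <;> linarith)).1
  have h2 := (hball (y := -(r / 2))
    (by rw [Real.dist_eq, sub_zero, abs_neg, abs_of_pos] <;> linarith)).1
  have h3 := nonneg_of_mul_nonneg_right (h0.trans h1) (half_pos hr)
  have h4 : liftAverage M β Φ P - liftAverage M β Φ Q ≤ 0 := by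
    rw [neg_mul] at h2
    exact nonpos_of_mul_nonpos_right (by linarith : r / 2 * _ ≤ 0) (half_pos hr)
  exact le_antisymm (sub_nonpos.1 h4) (sub_nonneg.1 h3)

theorem liftAverage_eq {P Q : V × ℝ} (hPQ : Relation.EqvGen (MaxStep M.graph d β L) P Q)
    {Φ : V × ℝ → ℝ}
    (hΦ : ∀ P Q, Relation.EqvGen (MaxStep M.graph d β L) P Q → Φ P = Φ Q) :
    liftAverage M β Φ P = liftAverage M β Φ Q := by
  induction hPQ with
  | rel _ _ h => exact H.liftAverage_eq_of_maxStep hκ h fun P Q h => hΦ P Q (.rel _ _ h)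
  | refl => rfl
  | symm _ _ _ ih => exact ih.symm
  | trans _ _ _ _ _ ih ih' => exact ih.trans ih'

end IsHarmonicCochain

end Invariance

/-! ### Classes of points joined by maximal steps -/

section MaximumPrinciple

variable {V : Type*} {G : SimpleGraph V} {d β : V → V → ℝ} {L : ℝ}

theorem eqvGen_maxStep_translate {P Q : V × ℝ} (h : Relation.EqvGen (MaxStep G d β L) P Q)
    (r : ℝ) : Relation.EqvGen (MaxStep G d β L) (P.1, P.2 + r) (Q.1, Q.2 + r) := by
  induction h with
  | rel _ _ h => exact .rel _ _ ⟨h.1, by dsimp only; rw [h.2.1]; ring, h.2.2⟩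
  | refl => exact .refl _
  | symm _ _ _ ih => exact ih.symm
  | trans _ _ _ _ _ ih ih' => exact ih.trans _ _ _ ih'

/-- The point `P` of the cover is an end of a step of maximal slope. -/
def IsMaxStepEnd (G : SimpleGraph V) (d β : V → V → ℝ) (L : ℝ) (P : V × ℝ) : Prop :=
  ∃ R, MaxStep G d β L R P ∨ MaxStep G d β L P R

theorem eq_or_isMaxStepEnd {P Q : V × ℝ} (h : Relation.EqvGen (MaxStep G d β L) P Q) :
    P = Q ∨ IsMaxStepEnd G d β L P ∧ IsMaxStepEnd G d β L Q := by
  induction h with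
  | rel P Q h => exact Or.inr ⟨⟨Q, Or.inr h⟩, ⟨P, Or.inl h⟩⟩
  | refl => exact Or.inl rfl
  | symm _ _ _ ih => exact ih.imp Eq.symm And.symm
  | trans _ _ _ _ _ ih ih' =>
    rcases ih with rfl | ih
    · exact ih'
    · rcases ih' with rfl | ih'
      · exact Or.inr ih
      · exact Or.inr ⟨ih.1, ih'.2⟩

/-- The heights in the cover `V × ℝ` of the points joined to `P` by steps of maximal slope. -/
def classHeights (G : SimpleGraph V) (d β : V → V → ℝ) (L : ℝ) (P : V × ℝ) : Set ℝ :=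
  Prod.snd '' {Q | Relation.EqvGen (MaxStep G d β L) P Q}

theorem classHeights_eq {P Q : V × ℝ} (h : Relation.EqvGen (MaxStep G d β L) P Q) :
    classHeights G d β L P = classHeights G d β L Q := by
  unfold classHeights
  congr 1
  ext R
  exact ⟨fun hR => h.symm.trans _ _ _ hR, fun hR => h.trans _ _ _ hR⟩

theorem mem_classHeights (P : V × ℝ) : P.2 ∈ classHeights G d β L P := ⟨P, .refl _, rfl⟩

theorem classHeights_add (a : V) (s r : ℝ) :
    classHeights G d β L (a, s + r) = (fun t => t + r) '' classHeights G d β L (a, s) := by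
  ext t
  constructor
  · rintro ⟨Q, hQ, rfl⟩
    have := eqvGen_maxStep_translate hQ (-r)
    rw [add_neg_cancel_right] at this
    exact ⟨Q.2 + -r, ⟨_, this, rfl⟩, by simp⟩
  · rintro ⟨_, ⟨Q, hQ, rfl⟩, rfl⟩
    exact ⟨_, eqvGen_maxStep_translate hQ r, rfl⟩

theorem classHeights_of_not_isMaxStepEnd {P : V × ℝ} (h : ¬ IsMaxStepEnd G d β L P) :
    classHeights G d β L P = {P.2} := by
  refine Set.Subset.antisymm ?_ (Set.singleton_subset_iff.2 (mem_classHeights P))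
  rintro _ ⟨Q, hQ, rfl⟩
  rcases eq_or_isMaxStepEnd hQ with rfl | h'
  · rfl
  · exact (h h'.1).elim

theorem sSup_classHeights_add (a : V) (s r : ℝ)
    (hb : Bornology.IsBounded (classHeights G d β L (a, s))) :
    sSup (classHeights G d β L (a, s + r)) = sSup (classHeights G d β L (a, s)) + r := by
  rw [classHeights_add]
  exact ((OrderIso.addRight r).map_csSup' ⟨_, mem_classHeights _⟩ hb.bddAbove).symm

theorem sInf_classHeights_add (a : V) (s r : ℝ)
    (hb : Bornology.IsBounded (classHeights G d β L (a, s))) :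
    sInf (classHeights G d β L (a, s + r)) = sInf (classHeights G d β L (a, s)) + r := by
  rw [classHeights_add]
  exact ((OrderIso.addRight r).map_csInf' ⟨_, mem_classHeights _⟩ hb.bddBelow).symm

end MaximumPrinciple

/-! ### Maximum principle for the oscillation of height -/

namespace IsHarmonicCochain

variable {V : Type*} [Fintype V] {M : MarkovChain V} {d β : V → V → ℝ} {L c : ℝ}
  (H : IsHarmonicCochain M d β L c)
include H

/-- The height averages to `P.2 + c`; the remaining sum has a sign when `Φ` lies above or below the
height. -/
theorem liftAverage_eq_add (Φ : V × ℝ → ℝ) (P : V × ℝ) :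
    liftAverage M β Φ P = P.2 + c +
      ∑ z, M.p P.1 z * (Φ (z, P.2 + β P.1 z) - (P.2 + β P.1 z)) := by
  simp only [liftAverage, mul_sub, mul_add, Finset.sum_sub_distrib, Finset.sum_add_distrib,
    ← Finset.sum_mul, M.sum_eq_one, H.divergence]
  ring

variable (hκ : ∀ x y : V, M.graph.Adj x y → 0 ≤ M.curvature d x y)
include hκ

/-- The average of the indicator of the class of the neighbour is positive at `(a, s)`, hence on its
whole class. So every point of that class has a lifted neighbour (possibly by a loop) in the bounded
class. -/
theorem isBounded_classHeights_of_adj {a z : V} {s : ℝ} (haz : M.graph.Adj a z)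
    (hz : Bornology.IsBounded (classHeights M.graph d β L (z, s + β a z))) :
    Bornology.IsBounded (classHeights M.graph d β L (a, s)) := by
  classical
  obtain ⟨K, hK⟩ := isBounded_iff_forall_norm_le.1 hz
  obtain ⟨C, hC⟩ := (Set.finite_range fun q : V × V => |β q.1 q.2|).bddAbove
  refine isBounded_iff_forall_norm_le.2 ⟨K + C, ?_⟩
  rintro _ ⟨Q, hQ, rfl⟩
  let Φ : V × ℝ → ℝ := fun R =>
    if Relation.EqvGen (MaxStep M.graph d β L) (z, s + β a z) R then 1 else 0
  have hΦ0 : ∀ R, 0 ≤ Φ R := fun R => by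
    dsimp only [Φ]
    split_ifs <;> norm_num
  have hΦ : ∀ P Q, Relation.EqvGen (MaxStep M.graph d β L) P Q → Φ P = Φ Q := fun P Q h => by
    have : Relation.EqvGen (MaxStep M.graph d β L) (z, s + β a z) P ↔
        Relation.EqvGen (MaxStep M.graph d β L) (z, s + β a z) Q :=
      ⟨fun h' => h'.trans _ _ _ h, fun h' => h'.trans _ _ _ h.symm⟩
    simp only [Φ, this]
  have hpos : 0 < liftAverage M β Φ (a, s) := by
    refine Finset.sum_pos' (fun w _ => mul_nonneg (M.nonneg _ _) (hΦ0 _))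
      ⟨z, Finset.mem_univ _, mul_pos haz.2 ?_⟩
    dsimp only [Φ]
    rw [if_pos (.refl _)]
    exact one_pos
  rw [H.liftAverage_eq hκ hQ hΦ] at hpos
  obtain ⟨w, -, hw⟩ := Finset.exists_ne_zero_of_sum_ne_zero hpos.ne'
  have hw' : Relation.EqvGen (MaxStep M.graph d β L) (z, s + β a z) (w, Q.2 + β Q.1 w) := by
    by_contra hw'
    exact hw (by simp [Φ, hw'])
  have h1 : |Q.2 + β Q.1 w| ≤ K := hK _ ⟨_, hw', rfl⟩
  have h2 : |β Q.1 w| ≤ C := hC ⟨(Q.1, w), rfl⟩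
  rw [Real.norm_eq_abs]
  rw [abs_le] at h1 h2 ⊢
  exact ⟨by linarith, by linarith⟩

theorem isBounded_classHeights {x : V} (hx : ∀ s, ¬ IsMaxStepEnd M.graph d β L (x, s))
    (P : V × ℝ) : Bornology.IsBounded (classHeights M.graph d β L P) := by
  suffices h : ∀ s, Bornology.IsBounded (classHeights M.graph d β L (P.1, s)) from h P.2
  obtain ⟨a, -⟩ := P
  induction M.irreducible a x using Relation.ReflTransGen.head_induction_on with
  | refl =>
    intro s
    rw [classHeights_of_not_isMaxStepEnd (hx s)]
    exact Bornology.isBounded_singleton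
  | @head a z haz _ ih =>
    intro s
    by_cases h : a = z
    · exact h ▸ ih s
    · exact H.isBounded_classHeights_of_adj hκ ⟨h, haz⟩ (ih _)

/-- The average may be computed at any point of the class, where infima lie below heights; then let
that point approach the infimum. -/
theorem liftAverage_sInf_le
    (hb : ∀ P, Bornology.IsBounded (classHeights M.graph d β L P))
    (P : V × ℝ) :
    liftAverage M β (fun R => sInf (classHeights M.graph d β L R)) P ≤
      sInf (classHeights M.graph d β L P) + c := by
  rw [← sub_le_iff_le_add]
  refine le_csInf ⟨_, mem_classHeights P⟩ ?_
  rintro _ ⟨Q, hQ, rfl⟩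
  rw [H.liftAverage_eq hκ hQ fun R S h => by rw [classHeights_eq h], H.liftAverage_eq_add]
  have : ∑ z, M.p Q.1 z * (sInf (classHeights M.graph d β L (z, Q.2 + β Q.1 z)) -
      (Q.2 + β Q.1 z)) ≤ 0 :=
    Finset.sum_nonpos fun z _ => mul_nonpos_of_nonneg_of_nonpos (M.nonneg _ _)
      (sub_nonpos.2 (csInf_le (hb _).bddBelow (mem_classHeights (z, Q.2 + β Q.1 z))))
  linarith

/-- The gain `δ` comes from stepping back down a maximal edge: the supremum at its lower end is that
of the upper end, so it exceeds the lower height by at least `L * d`. -/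
theorem add_le_liftAverage_sSup
    (hb : ∀ P, Bornology.IsBounded (classHeights M.graph d β L P))
    {δ : ℝ}
    (hδ : ∀ a b, M.graph.Adj a b → δ ≤ M.p b a * (L * d a b)) {P : V × ℝ}
    (hP : IsMaxStepEnd M.graph d β L P) :
    sSup (classHeights M.graph d β L P) + (c + δ) ≤
      liftAverage M β (fun R => sSup (classHeights M.graph d β L R)) P := by
  have hle : ∀ R : V × ℝ, R.2 ≤ sSup (classHeights M.graph d β L R) := fun R =>
    le_csSup (hb _).bddAbove (mem_classHeights R)
  have key : ∀ R Q, MaxStep M.graph d β L R Q → Q.2 + (c + δ) ≤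
      liftAverage M β (fun R => sSup (classHeights M.graph d β L R)) Q := by
    intro R Q h
    have hnn : ∀ z ∈ Finset.univ, 0 ≤ M.p Q.1 z *
        (sSup (classHeights M.graph d β L (z, Q.2 + β Q.1 z)) - (Q.2 + β Q.1 z)) := fun z _ =>
      mul_nonneg (M.nonneg _ _) (sub_nonneg.2 (hle (z, Q.2 + β Q.1 z)))
    have h1 := Finset.single_le_sum hnn (Finset.mem_univ R.1)
    have h2 : Q.2 + β Q.1 R.1 = R.2 := by rw [h.2.1, H.antisymm R.1 Q.1]; ring
    rw [h2, show (R.1, R.2) = R from rfl, classHeights_eq (.rel _ _ h)] at h1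
    have h3 : M.p Q.1 R.1 * (L * d R.1 Q.1) ≤
        M.p Q.1 R.1 * (sSup (classHeights M.graph d β L Q) - R.2) := by
      refine mul_le_mul_of_nonneg_left ?_ (M.nonneg _ _)
      rw [← h.2.2]
      linarith [hle Q, h.2.1]
    rw [H.liftAverage_eq_add]
    linarith [hδ _ _ h.1]
  rw [← le_sub_iff_add_le]
  refine csSup_le ⟨_, mem_classHeights P⟩ ?_
  rintro _ ⟨Q, hQ, rfl⟩
  rw [le_sub_iff_add_le, H.liftAverage_eq hκ hQ fun R S h => by rw [classHeights_eq h]]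
  have hQ' : IsMaxStepEnd M.graph d β L Q := by
    rcases eq_or_isMaxStepEnd hQ with rfl | h
    · exact hP
    · exact h.2
  obtain ⟨R, h | h⟩ := hQ'
  · exact key R Q h
  -- At a lower end the average can be taken at the upper end, whose height is no smaller.
  · rw [H.liftAverage_eq_of_maxStep hκ h fun R S h => by rw [classHeights_eq (.rel _ _ h)]]
    have h1 := key Q R h
    have h2 : 0 ≤ L * d Q.1 R.1 := mul_nonneg H.slope_pos.le (H.pathDistance.nonneg _ _)
    rw [← h.2.2] at h2
    linarith [h.2.1]

/-- In non-negative curvature, the edges on which a harmonic cochain has maximal slope meet every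
vertex. -/
theorem exists_isMaxStepEnd {P Q : V × ℝ} (hPQ : MaxStep M.graph d β L P Q) (x : V) :
    ∃ s, IsMaxStepEnd M.graph d β L (x, s) := by
  by_contra! hx
  have hb := H.isBounded_classHeights hκ hx
  classical
  have : Nonempty V := ⟨x⟩
  -- The value `1` off the edges keeps the minimum positive, even if there are no edges.
  obtain ⟨q, hq⟩ := Finite.exists_min fun q : V × V =>
    if M.graph.Adj q.1 q.2 then M.p q.2 q.1 * (L * d q.1 q.2) else 1
  set δ := if M.graph.Adj q.1 q.2 then M.p q.2 q.1 * (L * d q.1 q.2) else 1 with hδdef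
  have hδ0 : 0 < δ := by
    rw [hδdef]
    split_ifs with h
    · exact mul_pos h.symm.2 (mul_pos H.slope_pos (H.pathDistance.pos h.ne))
    · exact one_pos
  have hδ : ∀ a b, M.graph.Adj a b → δ ≤ M.p b a * (L * d a b) := fun a b hab => by
    simpa [hab] using hq (a, b)
  let ω : V → ℝ := fun a => sSup (classHeights M.graph d β L (a, 0)) -
    sInf (classHeights M.graph d β L (a, 0))
  -- Vertical translation shifts supremum and infimum alike, so the oscillation depends only on the
  -- vertex.
  have hω : ∀ R : V × ℝ, sSup (classHeights M.graph d β L R) -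
      sInf (classHeights M.graph d β L R) = ω R.1 := fun R => by
    have h1 := sSup_classHeights_add R.1 0 R.2 (hb _)
    have h2 := sInf_classHeights_add R.1 0 R.2 (hb _)
    rw [zero_add] at h1 h2
    rw [show R = (R.1, R.2) from rfl, h1, h2]
    simp only [ω]
    ring
  obtain ⟨a, ha⟩ := Finite.exists_max ω
  have hpos : 0 < ω a := by
    refine lt_of_lt_of_le ?_ (ha P.1)
    rw [← hω P]
    have h1 := csInf_le (hb P).bddBelow (mem_classHeights P)
    have h2 := le_csSup (hb P).bddAbove ⟨Q, .rel _ _ hPQ, rfl⟩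
    have h3 := mul_pos H.slope_pos (H.pathDistance.pos hPQ.1.ne)
    rw [← hPQ.2.2] at h3
    linarith [hPQ.2.1]
  have hend : IsMaxStepEnd M.graph d β L (a, 0) := by
    by_contra h
    have := hω (a, 0)
    rw [classHeights_of_not_isMaxStepEnd h, csSup_singleton, csInf_singleton, sub_self] at this
    exact hpos.ne this
  have h1 := H.add_le_liftAverage_sSup hκ hb hδ hend
  have h2 := H.liftAverage_sInf_le hκ hb (a, 0)
  have h3 : liftAverage M β (fun R => sSup (classHeights M.graph d β L R)) (a, 0) -
      liftAverage M β (fun R => sInf (classHeights M.graph d β L R)) (a, 0) ≤ ω a := by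
    rw [liftAverage, liftAverage, ← Finset.sum_sub_distrib]
    calc _ = ∑ z, M.p a z * ω z := Finset.sum_congr rfl fun z _ => by rw [← mul_sub, hω]
      _ ≤ ∑ z, M.p a z * ω a :=
        Finset.sum_le_sum fun z _ => mul_le_mul_of_nonneg_left (ha z) (M.nonneg _ _)
      _ = ω a := by rw [← Finset.sum_mul, M.sum_eq_one, one_mul]
  have h4 := hω (a, 0)
  dsimp only at h4
  linarith

end IsHarmonicCochain

/-! ### Solving for constant divergence -/

namespace MarkovChain

variable {V : Type*} [Fintype V] (M : MarkovChain V)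

/-- At a maximum a non-negative Laplacian forces equality at all successors; irreducibility spreads
it. -/
theorem eq_of_forall_le_of_laplacian_nonneg {f : V → ℝ} {a : V} (ha : ∀ y, f y ≤ f a)
    (hΔ : ∀ y, 0 ≤ M.laplacian f y) (b : V) : f b = f a := by
  induction M.irreducible a b with
  | refl => rfl
  | @tail y z _ hyz ih =>
    have hnn : ∀ w ∈ Finset.univ, 0 ≤ M.p y w * (f y - f w) := fun w _ =>
      mul_nonneg (M.nonneg _ _) (by rw [ih]; exact sub_nonneg.2 (ha w))
    have h1 := Finset.single_le_sum hnn (Finset.mem_univ z)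
    have h2 : ∑ w, M.p y w * (f y - f w) = -M.laplacian f y := by
      rw [laplacian, ← Finset.sum_neg_distrib]
      exact Finset.sum_congr rfl fun w _ => by ring
    have h3 := hΔ y
    have h4 : f y - f z ≤ 0 := nonpos_of_mul_nonpos_right (by linarith) hyz
    exact le_antisymm (ha z) (by rw [← ih]; linarith)

theorem eq_of_laplacian_eq_const {f : V → ℝ} {r : ℝ} (hf : ∀ y, M.laplacian f y = r) (a b : V) :
    f a = f b ∧ r = 0 := by
  have : Nonempty V := ⟨a⟩
  have key : ∀ (g : V → ℝ) (s : ℝ), 0 ≤ s → (∀ y, M.laplacian g y = s) → g a = g b ∧ s = 0 := by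
    intro g s hs hg
    obtain ⟨m, hm⟩ := Finite.exists_max g
    have hc := M.eq_of_forall_le_of_laplacian_nonneg hm fun y => (hg y).symm ▸ hs
    exact ⟨(hc a).trans (hc b).symm, by rw [← hg a]; simp [laplacian, hc]⟩
  rcases le_total 0 r with hr | hr
  · exact key f r hr hf
  · have := key (fun v => -1 * f v) (-r) (by linarith) fun y => by
      rw [M.laplacian_const_mul, hf]; ring
    exact ⟨by linarith [this.1], by linarith [this.2]⟩

/-- The range of the Laplacian is a complement of the constant functions. -/
theorem exists_laplacian_add_const [Nonempty V] (g : V → ℝ) :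
    ∃ (f : V → ℝ) (c : ℝ), ∀ a, M.laplacian f a + c = g a := by
  obtain ⟨x⟩ := ‹Nonempty V›
  -- Adding the value at `x` makes the Laplacian injective, hence surjective by finite dimension.
  let T : (V → ℝ) →ₗ[ℝ] (V → ℝ) :=
    { toFun := fun f a => M.laplacian f a + f x
      map_add' := fun f h => by
        ext a
        simp only [laplacian, Pi.add_apply]
        rw [add_add_add_comm, ← Finset.sum_add_distrib]
        congr 1
        exact Finset.sum_congr rfl fun y _ => by ring
      map_smul' := fun r f => by
        ext a
        simp only [laplacian, Pi.smul_apply, smul_eq_mul, RingHom.id_apply, mul_add,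
          Finset.mul_sum]
        congr 1
        exact Finset.sum_congr rfl fun y _ => by ring }
  have hT : Function.Injective T := by
    rw [injective_iff_map_eq_zero]
    intro f hf
    have h : ∀ a, M.laplacian f a = -f x := fun a =>
      eq_neg_of_add_eq_zero_left (congrFun hf a)
    ext a
    obtain ⟨h1, h2⟩ := M.eq_of_laplacian_eq_const h a x
    rw [h1, neg_eq_zero.1 h2, Pi.zero_apply]
  obtain ⟨f, hf⟩ := LinearMap.injective_iff_surjective.1 hT g
  exact ⟨f, f x, congrFun hf⟩

/-- Every 1-cochain is cohomologous to one with constant divergence. -/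
theorem exists_divergence_eq_const [Nonempty V] (α : Cochain1 M.graph) :
    ∃ (f : V → ℝ) (c : ℝ), ∀ a, ∑ z, M.p a z * (α - coboundary0 M.graph f).1 a z = c := by
  obtain ⟨f, c, hf⟩ := M.exists_laplacian_add_const fun a => ∑ z, M.p a z * α.1 a z
  -- The coboundary of `-f` on `(a, z)` is `f z - f a`, whose average is the Laplacian of `f`.
  refine ⟨fun v => -1 * f v, c, fun a => ?_⟩
  have h : ∀ z, M.p a z * (α - coboundary0 M.graph fun v => -1 * f v).1 a z =
      M.p a z * α.1 a z - M.p a z * (f z - f a) := by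
    intro z
    have h1 : (α - coboundary0 M.graph fun v => -1 * f v).1 a z =
        α.1 a z - (coboundary0 M.graph fun v => -1 * f v).1 a z := rfl
    rw [h1]
    by_cases haz : M.graph.Adj a z
    · simp only [coboundary0, LinearMap.coe_mk, AddHom.coe_mk, if_pos haz]
      ring
    · simp only [coboundary0, LinearMap.coe_mk, AddHom.coe_mk, if_neg haz]
      by_cases h2 : a = z
      · simp [h2]
      · have : M.p a z = 0 := le_antisymm (not_lt.1 fun h => haz ⟨h2, h⟩) (M.nonneg _ _)
        simp [this]
  rw [Finset.sum_congr rfl fun z _ => h z, Finset.sum_sub_distrib, ← hf a]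
  simp [laplacian]

end MarkovChain

/-! ### Vanishing of the cohomology -/

/-- A closed 1-cochain with constant divergence vanishes under the curvature assumptions. -/
theorem cochain_eq_zero_of_curvature {V : Type*} [Fintype V] {M : MarkovChain V} {d : V → V → ℝ}
    (hd : IsPathDistance M.graph d)
    (hnonneg : ∀ x y : V, M.graph.Adj x y → 0 ≤ M.curvature d x y)
    {x : V} (hpos : ∀ y : V, M.graph.Adj x y → 0 < M.curvature d x y)
    {α : Cochain1 M.graph} (hα : coboundary1 M.graph d α = 0) {c : ℝ}
    (hc : ∀ a, ∑ z, M.p a z * α.1 a z = c) : α = 0 := by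
  by_contra h0
  have : Nonempty V := ⟨x⟩
  obtain ⟨⟨a, b⟩, hab⟩ := Finite.exists_max fun q : V × V => α.1 q.1 q.2 / d q.1 q.2
  set L := α.1 a b / d a b with hLdef
  have hle : ∀ u v, u ≠ v → α.1 u v ≤ L * d u v := fun u v huv =>
    (div_le_iff₀ (hd.pos huv)).1 (hab (u, v))
  have hself : ∀ u, α.1 u u = 0 := fun u => α.2.2 u u (M.graph.loopless.irrefl u)
  -- If no slope is positive, antisymmetry makes all of them zero.
  have hL : 0 < L := by
    by_contra hL
    refine h0 (Subtype.ext (funext fun u => funext fun v => ?_))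
    change α.1 u v = 0
    by_cases huv : u = v
    · rw [huv, hself]
    · have h1 := hle u v huv
      have h2 := hle v u (Ne.symm huv)
      have h3 := mul_nonpos_of_nonpos_of_nonneg (not_lt.1 hL) (hd.nonneg u v)
      have h4 := mul_nonpos_of_nonpos_of_nonneg (not_lt.1 hL) (hd.nonneg v u)
      have := α.2.1 u v
      linarith
  have hadj : M.graph.Adj a b := by
    by_contra h
    rw [hLdef, α.2.2 a b h, zero_div] at hL
    exact hL.false
  have H : IsHarmonicCochain M d α.1 L c :=
    { pathDistance := hd
      antisymm := α.2.1
      eq_zero := α.2.2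
      closed := congrFun hα
      divergence := hc
      le_slope := fun u v huv => hle u v huv.ne
      slope_pos := hL }
  have hstep : MaxStep M.graph d α.1 L (a, 0) (b, α.1 a b) :=
    ⟨hadj, (zero_add _).symm, (div_mul_cancel₀ _ (hd.pos hadj.ne).ne').symm⟩
  obtain ⟨s, ⟨y, t⟩, h | h⟩ := H.exists_isMaxStepEnd hnonneg hstep x
  · exact (hpos y h.1.symm).not_ge (H.curvature_nonpos h).2
  · exact (hpos y h.1).not_ge (H.curvature_nonpos h).1

theorem mainTheorem12 {V : Type*} [Fintype V] (M : MarkovChain V) (d : V → V → ℝ)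
    (hd : IsPathDistance M.graph d)
    (hnonneg : ∀ x y : V, M.graph.Adj x y → 0 ≤ M.curvature d x y)
    (x : V) (hpos : ∀ y : V, M.graph.Adj x y → 0 < M.curvature d x y) :
    betti1 M.graph d = 0 := by
  have : Nonempty V := ⟨x⟩
  have htop : (LinearMap.range (coboundary0 M.graph)).submoduleOf
      (LinearMap.ker (coboundary1 M.graph d)) = ⊤ := by
    rw [Submodule.submoduleOf, Submodule.comap_subtype_eq_top]
    intro α hα
    obtain ⟨f, c, hf⟩ := M.exists_divergence_eq_const α
    have hcl : coboundary1 M.graph d (α - coboundary0 M.graph f) = 0 := by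
      have := LinearMap.congr_fun (coboundary1_comp_coboundary0 M.graph d) f
      rw [LinearMap.comp_apply] at this
      rw [map_sub, LinearMap.mem_ker.1 hα, this]
      simp
    have := cochain_eq_zero_of_curvature hd hnonneg hpos hcl hf
    exact ⟨f, (sub_eq_zero.1 this).symm⟩
  have := Submodule.Quotient.subsingleton_iff.2 htop
  exact Module.finrank_zero_of_subsingleton
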